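/- Let $\boldsymbol{ax+b}=\{(a,b): a>0,\ b\in\mathbb{R}\}$ be the group of affine transformations $x\mapsto ax+b$ of $\mathbb{R}$, with product $(a,b)(c,d)=(ac,\,ad+b)$ and inverse $(a,b)^{-1}=(1/a,\,-b/a)$, equipped with the topology inherited from $\mathbb{R}^2$ and with a left Haar measure (that is, a positive multiple of $da\,db/a^2$). For $\alpha>0$ let $\omega_\alpha(a,b)=(1+a+|b|)^\alpha$, a continuous weight on $\boldsymbol{ax+b}$, i.e. a positive continuous function with $\omega_\alpha(xy)\le\omega_\alpha(x)\omega_\alpha(y)$. Let $L^1(\boldsymbol{ax+b},\omega_\alpha)$ be the Beurling algebra of all (classes modulo a.e. equality of) measurable functions $f:\boldsymbol{ax+b}\to\mathbb{C}$ with $\|f\|_{\omega_\alpha}=\int |f(x)|\,\omega_\alpha(x)\,dx<\infty$, with the convolution product $(f*g)(x)=\int f(y)\,g(y^{-1}x)\,dy$. A Banach algebra $A$ is called weakly amenable if every continuous derivation $D:A\to A^*$, i.e. every continuous linear map with $D(ab)=a\cdot D(b)+D(a)\cdot b$ for all $a,b\in A$, is inner, i.e. of the form $D(a)=a\cdot\varphi-\varphi\cdot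 a$ for some $\varphi\in A^*$; here $\langle x,a\cdot\varphi\rangle=\langle xa,\varphi\rangle$ and $\langle x,\varphi\cdot a\rangle=\langle ax,\varphi\rangle$. Then for every $\alpha>0$ the Beurling algebra $L^1(\boldsymbol{ax+b},\omega_\alpha)$ is not weakly amenable. -/

import Mathlib

open MeasureTheory
open scoped ENNReal

/-! ### Weak amenability -/

section WeakAmenability

variable {A : Type*} [NonUnitalNormedRing A] [NormedSpace ℂ A] [IsScalarTower ℂ A A]
  [SMulCommClass ℂ A A]

/-- The left action of `A` on its Banach dual: `⟨x, a · φ⟩ = ⟨x a, φ⟩`. -/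
noncomputable def dualLeft (a : A) (φ : A →L[ℂ] ℂ) : A →L[ℂ] ℂ :=
  φ.comp ((ContinuousLinearMap.mul ℂ A).flip a)

/-- The right action of `A` on its Banach dual: `⟨x, φ · a⟩ = ⟨a x, φ⟩`. -/
noncomputable def dualRight (φ : A →L[ℂ] ℂ) (a : A) : A →L[ℂ] ℂ :=
  φ.comp (ContinuousLinearMap.mul ℂ A a)

theorem dualLeft_apply (a : A) (φ : A →L[ℂ] ℂ) (x : A) : dualLeft a φ x = φ (x * a) := rfl

theorem dualRight_apply (φ : A →L[ℂ] ℂ) (a x : A) : dualRight φ a x = φ (a * x) := rfl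

/-- The continuous linear map `D : A → A*` is a derivation. -/
def IsDerivationToDual (D : A →L[ℂ] (A →L[ℂ] ℂ)) : Prop :=
  ∀ a b : A, D (a * b) = dualLeft a (D b) + dualRight (D a) b

/-- The map `D : A → A*` is an inner derivation. -/
def IsInnerToDual (D : A →L[ℂ] (A →L[ℂ] ℂ)) : Prop :=
  ∃ φ : A →L[ℂ] ℂ, ∀ a : A, D a = dualLeft a φ - dualRight φ a

variable (A) in
/-- A complex Banach algebra `A` is weakly amenable if every continuous derivation from `A` into
its dual bimodule `A*` is inner. -/
def IsWeaklyAmenable : Prop :=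
  ∀ D : A →L[ℂ] (A →L[ℂ] ℂ), IsDerivationToDual D → IsInnerToDual D

end WeakAmenability

/-! ### Weights and Beurling algebras -/

/-- A (continuous) weight on a topological group. -/
structure GroupWeight (G : Type*) [Group G] [TopologicalSpace G] where
  /-- the underlying function -/
  toFun : G → ℝ
  continuous_toFun : Continuous toFun
  pos : ∀ x, 0 < toFun x
  submul : ∀ x y, toFun (x * y) ≤ toFun x * toFun y

/-- Convolution with respect to the measure `μ`. -/
noncomputable def groupConv {G : Type*} [Group G] [MeasurableSpace G] (μ : Measure G)
    (f g : G → ℂ) (x : G) : ℂ :=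
  ∫ y, f y * g (y⁻¹ * x) ∂μ

section Convolution

variable {G : Type*} [Group G] [MeasurableSpace G] {μ : Measure G}

theorem enorm_groupConv_le (f g : G → ℂ) (x : G) :
    ‖groupConv μ f g x‖ₑ ≤ mlconvolution (fun y => ‖f y‖ₑ) (fun y => ‖g y‖ₑ) μ x := by
  refine (enorm_integral_le_lintegral_enorm _).trans (le_of_eq ?_)
  simp [mlconvolution_def, enorm_mul]

variable [MeasurableMul₂ G] [MeasurableInv G] [SFinite μ] [μ.IsMulLeftInvariant]

theorem quasi_inv_mul (x : G) :
    Measure.QuasiMeasurePreserving (fun y : G => y⁻¹ * x) μ μ :=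
  (quasiMeasurePreserving_mul_right μ x).comp (quasiMeasurePreserving_inv μ)

theorem groupConv_congr {f f' g g' : G → ℂ} (hf : f =ᵐ[μ] f') (hg : g =ᵐ[μ] g') :
    groupConv μ f g = groupConv μ f' g' := by
  funext x
  refine integral_congr_ae ?_
  filter_upwards [hf, (quasi_inv_mul (μ := μ) x).ae_eq_comp hg] with y h1 h2
  simp only [Function.comp] at h2
  rw [h1, h2]

theorem aesm_kernel {f g : G → ℂ} (hf : AEStronglyMeasurable f μ)
    (hg : AEStronglyMeasurable g μ) (x : G) :
    AEStronglyMeasurable (fun y => f y * g (y⁻¹ * x)) μ :=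
  hf.mul (hg.comp_quasiMeasurePreserving (quasi_inv_mul x))

theorem aesm_groupConv {f g : G → ℂ} (hf : AEStronglyMeasurable f μ)
    (hg : AEStronglyMeasurable g μ) : AEStronglyMeasurable (groupConv μ f g) μ := by
  have h : AEStronglyMeasurable (fun p : G × G => f p.2 * g (p.2⁻¹ * p.1)) (μ.prod μ) :=
    (hf.comp_quasiMeasurePreserving Measure.quasiMeasurePreserving_snd).mul
      (hg.comp_quasiMeasurePreserving (quasiMeasurePreserving_inv_mul_swap μ μ))
  exact h.integral_prod_right'

theorem integrable_kernel {f g : G → ℂ} (hf : AEStronglyMeasurable f μ)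
    (hg : AEStronglyMeasurable g μ) {x : G}
    (h : mlconvolution (fun y => ‖f y‖ₑ) (fun y => ‖g y‖ₑ) μ x < ∞) :
    Integrable (fun y => f y * g (y⁻¹ * x)) μ := by
  refine ⟨aesm_kernel hf hg x, ?_⟩
  simpa [HasFiniteIntegral, mlconvolution_def, enorm_mul] using h

theorem lintegral_mlconvolution {f g : G → ℝ≥0∞} (hf : AEMeasurable f μ)
    (hg : AEMeasurable g μ) :
    ∫⁻ x, mlconvolution f g μ x ∂μ = (∫⁻ x, f x ∂μ) * ∫⁻ x, g x ∂μ := by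
  simp only [mlconvolution_def]
  have hm : AEMeasurable (fun p : G × G => f p.2 * g (p.2⁻¹ * p.1)) (μ.prod μ) :=
    (hf.comp_quasiMeasurePreserving Measure.quasiMeasurePreserving_snd).mul
      (hg.comp_quasiMeasurePreserving (quasiMeasurePreserving_inv_mul_swap μ μ))
  rw [lintegral_lintegral_swap hm]
  have : ∀ y, ∫⁻ x, f y * g (y⁻¹ * x) ∂μ = f y * ∫⁻ x, g x ∂μ := by
    intro y
    have hy : AEMeasurable (fun x => g (y⁻¹ * x)) μ := hg.comp_quasiMeasurePreserving
      (measurePreserving_mul_left μ y⁻¹).quasiMeasurePreserving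
    rw [lintegral_const_mul'' _ hy, lintegral_mul_left_eq_self g y⁻¹]
  simp only [this]
  rw [lintegral_mul_const'' _ hf]

theorem groupConv_assoc_apply {f g h : G → ℂ} (hf : AEStronglyMeasurable f μ)
    (hg : AEStronglyMeasurable g μ) (hh : AEStronglyMeasurable h μ) {x : G}
    (hx : mlconvolution (mlconvolution (fun y => ‖f y‖ₑ) (fun y => ‖g y‖ₑ) μ)
      (fun y => ‖h y‖ₑ) μ x < ∞) :
    groupConv μ (groupConv μ f g) h x = groupConv μ f (groupConv μ g h) x := by
  have hm : AEStronglyMeasurable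
      (fun p : G × G => f p.2 * g (p.2⁻¹ * p.1) * h (p.1⁻¹ * x)) (μ.prod μ) :=
    ((hf.comp_quasiMeasurePreserving Measure.quasiMeasurePreserving_snd).mul
      (hg.comp_quasiMeasurePreserving (quasiMeasurePreserving_inv_mul_swap μ μ))).mul
      ((hh.comp_quasiMeasurePreserving (quasi_inv_mul x)).comp_quasiMeasurePreserving
        Measure.quasiMeasurePreserving_fst)
  have hi : Integrable
      (fun p : G × G => f p.2 * g (p.2⁻¹ * p.1) * h (p.1⁻¹ * x)) (μ.prod μ) := by
    refine ⟨hm, ?_⟩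
    rw [HasFiniteIntegral, lintegral_prod _ hm.enorm]
    refine lt_of_eq_of_lt ?_ hx
    rw [mlconvolution_def]
    refine lintegral_congr fun z => ?_
    rw [mlconvolution_def, ← lintegral_mul_const'' _ (by
      simpa [enorm_mul] using (aesm_kernel hf hg z).enorm)]
    simp [enorm_mul]
  calc groupConv μ (groupConv μ f g) h x
      = ∫ z, ∫ y, f y * g (y⁻¹ * z) * h (z⁻¹ * x) ∂μ ∂μ := by
        simp only [groupConv, ← integral_mul_const]
    _ = ∫ y, ∫ z, f y * g (y⁻¹ * z) * h (z⁻¹ * x) ∂μ ∂μ := integral_integral_swap hi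
    _ = groupConv μ f (groupConv μ g h) x := by
        simp only [groupConv]
        refine integral_congr_ae (Filter.Eventually.of_forall fun y => ?_)
        simp only [mul_assoc]
        rw [integral_const_mul]
        congr 1
        rw [← integral_mul_left_eq_self (fun z => g z * h (z⁻¹ * (y⁻¹ * x))) y⁻¹]
        simp [mul_assoc]

end Convolution

namespace GroupWeight

section Basic

variable {G : Type*} [Group G] [TopologicalSpace G]

/-- The weight as an extended nonnegative function. -/
noncomputable def ennreal (ω : GroupWeight G) (x : G) : ℝ≥0∞ := ENNReal.ofReal (ω.toFun x)

theorem ennreal_ne_zero (ω : GroupWeight G) (x : G) : ω.ennreal x ≠ 0 := by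
  simpa [ennreal] using ω.pos x

theorem ennreal_mul_le (ω : GroupWeight G) (x y : G) :
    ω.ennreal (x * y) ≤ ω.ennreal x * ω.ennreal y := by
  simp only [ennreal]
  rw [← ENNReal.ofReal_mul (ω.pos x).le]
  exact ENNReal.ofReal_le_ofReal (ω.submul x y)

variable [MeasurableSpace G]

/-- The measure `ω dμ`. -/
noncomputable def measure (ω : GroupWeight G) (μ : Measure G) : Measure G :=
  μ.withDensity ω.ennreal

theorem measure_ac (ω : GroupWeight G) (μ : Measure G) : ω.measure μ ≪ μ :=
  withDensity_absolutelyContinuous _ _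

variable [BorelSpace G]

theorem measurable_ennreal (ω : GroupWeight G) : Measurable ω.ennreal :=
  ω.continuous_toFun.measurable.ennreal_ofReal

variable (ω : GroupWeight G) (μ : Measure G)

theorem ac_measure : μ ≪ ω.measure μ :=
  withDensity_absolutelyContinuous' ω.measurable_ennreal.aemeasurable
    (Filter.Eventually.of_forall ω.ennreal_ne_zero)

variable {ω μ}

theorem ae_measure_iff {p : G → Prop} : (∀ᵐ x ∂ω.measure μ, p x) ↔ ∀ᵐ x ∂μ, p x :=
  ⟨fun h => (ac_measure ω μ).ae_le h, fun h => (measure_ac ω μ).ae_le h⟩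

theorem lintegral_measure (f : G → ℝ≥0∞) (hf : AEMeasurable f μ) :
    ∫⁻ x, f x ∂ω.measure μ = ∫⁻ x, ω.ennreal x * f x ∂μ :=
  lintegral_withDensity_eq_lintegral_mul₀ ω.measurable_ennreal.aemeasurable hf

theorem memLp_iff {f : G → ℂ} : MemLp f 1 (ω.measure μ) ↔
    AEStronglyMeasurable f μ ∧ ∫⁻ x, ω.ennreal x * ‖f x‖ₑ ∂μ < ∞ := by
  constructor
  · intro h
    have h1 : AEStronglyMeasurable f μ := h.1.mono_ac (ac_measure ω μ)
    refine ⟨h1, ?_⟩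
    have h2 := h.2
    rwa [eLpNorm_one_eq_lintegral_enorm, lintegral_measure _ h1.enorm] at h2
  · rintro ⟨h1, h2⟩
    refine ⟨h1.mono_ac (measure_ac ω μ), ?_⟩
    rwa [eLpNorm_one_eq_lintegral_enorm, lintegral_measure _ h1.enorm]

end Basic

variable {G : Type*} [Group G] [TopologicalSpace G] [IsTopologicalGroup G]
  [SecondCountableTopology G] [MeasurableSpace G] [BorelSpace G]
  {ω : GroupWeight G} {μ : Measure G} [SFinite μ] [μ.IsMulLeftInvariant]

theorem lintegral_mlconvolution_le {f g : G → ℝ≥0∞} (hf : AEMeasurable f μ)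
    (hg : AEMeasurable g μ) :
    ∫⁻ x, ω.ennreal x * mlconvolution f g μ x ∂μ ≤
      (∫⁻ x, ω.ennreal x * f x ∂μ) * ∫⁻ x, ω.ennreal x * g x ∂μ := by
  have hω := ω.measurable_ennreal.aemeasurable (μ := μ)
  refine le_of_le_of_eq ?_ (lintegral_mlconvolution (hω.mul hf) (hω.mul hg))
  refine lintegral_mono fun x => ?_
  have hx : AEMeasurable (fun y => f y * g (y⁻¹ * x)) μ :=
    hf.mul (hg.comp_quasiMeasurePreserving (quasi_inv_mul x))
  simp only [mlconvolution_def]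
  rw [← lintegral_const_mul'' _ hx]
  refine lintegral_mono fun y => ?_
  have h := ω.ennreal_mul_le y (y⁻¹ * x)
  rw [mul_inv_cancel_left] at h
  calc ω.ennreal x * (f y * g (y⁻¹ * x))
      ≤ (ω.ennreal y * ω.ennreal (y⁻¹ * x)) * (f y * g (y⁻¹ * x)) := by gcongr
    _ = ω.ennreal y * f y * (ω.ennreal (y⁻¹ * x) * g (y⁻¹ * x)) := by ring

theorem ae_mlconvolution_lt_top {f g : G → ℝ≥0∞} (hf : AEMeasurable f μ)
    (hg : AEMeasurable g μ) (hf' : ∫⁻ x, ω.ennreal x * f x ∂μ < ∞)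
    (hg' : ∫⁻ x, ω.ennreal x * g x ∂μ < ∞) :
    ∀ᵐ x ∂μ, mlconvolution f g μ x < ∞ := by
  have h := (lintegral_mlconvolution_le (ω := ω) hf hg).trans_lt (ENNReal.mul_lt_top hf' hg')
  have hm : AEMeasurable (fun x => ω.ennreal x * mlconvolution f g μ x) μ :=
    ω.measurable_ennreal.aemeasurable.mul (aemeasurable_mlconvolution hf hg)
  filter_upwards [ae_lt_top' hm h.ne] with x hx
  exact (ENNReal.mul_lt_top_iff.1 hx).elim (fun h => h.2)
    (fun h => h.elim (fun h => absurd h (ω.ennreal_ne_zero x)) (fun h => by simp [h]))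

theorem eLpNorm_groupConv_le {f g : G → ℂ} (hf : AEStronglyMeasurable f μ)
    (hg : AEStronglyMeasurable g μ) :
    eLpNorm (groupConv μ f g) 1 (ω.measure μ) ≤
      eLpNorm f 1 (ω.measure μ) * eLpNorm g 1 (ω.measure μ) := by
  simp only [eLpNorm_one_eq_lintegral_enorm]
  rw [lintegral_measure _ hf.enorm, lintegral_measure _ hg.enorm,
    lintegral_measure _ (aesm_groupConv hf hg).enorm]
  refine le_trans (lintegral_mono fun x => ?_) (lintegral_mlconvolution_le hf.enorm hg.enorm)
  gcongr
  exact enorm_groupConv_le f g x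

theorem memLp_groupConv {f g : G → ℂ} (hf : MemLp f 1 (ω.measure μ))
    (hg : MemLp g 1 (ω.measure μ)) : MemLp (groupConv μ f g) 1 (ω.measure μ) := by
  have hf1 := (memLp_iff.1 hf).1
  have hg1 := (memLp_iff.1 hg).1
  exact ⟨(aesm_groupConv hf1 hg1).mono_ac (measure_ac ω μ),
    (eLpNorm_groupConv_le hf1 hg1).trans_lt (ENNReal.mul_lt_top hf.2 hg.2)⟩

theorem ae_integrable_kernel {f g : G → ℂ} (hf : MemLp f 1 (ω.measure μ))
    (hg : MemLp g 1 (ω.measure μ)) :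
    ∀ᵐ x ∂μ, Integrable (fun y => f y * g (y⁻¹ * x)) μ := by
  obtain ⟨hf1, hf2⟩ := memLp_iff.1 hf
  obtain ⟨hg1, hg2⟩ := memLp_iff.1 hg
  filter_upwards [ae_mlconvolution_lt_top (ω := ω) hf1.enorm hg1.enorm hf2 hg2] with x hx
  exact integrable_kernel hf1 hg1 hx

theorem groupConv_assoc_ae {f g h : G → ℂ} (hf : MemLp f 1 (ω.measure μ))
    (hg : MemLp g 1 (ω.measure μ)) (hh : MemLp h 1 (ω.measure μ)) :
    groupConv μ (groupConv μ f g) h =ᵐ[μ] groupConv μ f (groupConv μ g h) := by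
  obtain ⟨hf1, hf2⟩ := memLp_iff.1 hf
  obtain ⟨hg1, hg2⟩ := memLp_iff.1 hg
  obtain ⟨hh1, hh2⟩ := memLp_iff.1 hh
  have hfg := (lintegral_mlconvolution_le (ω := ω) hf1.enorm hg1.enorm).trans_lt
    (ENNReal.mul_lt_top hf2 hg2)
  filter_upwards [ae_mlconvolution_lt_top (ω := ω)
    (aemeasurable_mlconvolution hf1.enorm hg1.enorm) hh1.enorm hfg hh2] with x hx
  exact groupConv_assoc_apply hf1 hg1 hh1 hx

end GroupWeight

/-- The Beurling algebra `L¹(G, ω)`: classes modulo almost everywhere equality of measurable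
functions `f : G → ℂ` with `∫ |f| ω dμ < ∞`. -/
def BeurlingAlgebra {G : Type*} [Group G] [TopologicalSpace G] [MeasurableSpace G]
    (μ : Measure G) (ω : GroupWeight G) : Type _ :=
  Lp ℂ 1 (ω.measure μ)

namespace BeurlingAlgebra

variable {G : Type*} [Group G] [TopologicalSpace G] [MeasurableSpace G]
  {ω : GroupWeight G} {μ : Measure G}

noncomputable instance : NormedAddCommGroup (BeurlingAlgebra μ ω) :=
  inferInstanceAs (NormedAddCommGroup (Lp ℂ 1 (ω.measure μ)))

noncomputable instance : NormedSpace ℂ (BeurlingAlgebra μ ω) :=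
  inferInstanceAs (NormedSpace ℂ (Lp ℂ 1 (ω.measure μ)))

instance : CompleteSpace (BeurlingAlgebra μ ω) :=
  inferInstanceAs (CompleteSpace (Lp ℂ 1 (ω.measure μ)))

/-- A representative of a class. -/
noncomputable def rep (f : BeurlingAlgebra μ ω) : G → ℂ :=
  ((show Lp ℂ 1 (ω.measure μ) from f : Lp ℂ 1 (ω.measure μ)) : G → ℂ)

theorem memLp_rep (f : BeurlingAlgebra μ ω) : MemLp f.rep 1 (ω.measure μ) :=
  Lp.memLp (show Lp ℂ 1 (ω.measure μ) from f)

/-- The class of a function in the weighted space. -/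
noncomputable def mk (f : G → ℂ) (hf : MemLp f 1 (ω.measure μ)) : BeurlingAlgebra μ ω :=
  (hf.toLp f : Lp ℂ 1 (ω.measure μ))

theorem enorm_eq (f : BeurlingAlgebra μ ω) : ‖f‖ₑ = eLpNorm f.rep 1 (ω.measure μ) :=
  Lp.enorm_def (show Lp ℂ 1 (ω.measure μ) from f)

variable [BorelSpace G]

theorem rep_mk (f : G → ℂ) (hf : MemLp f 1 (ω.measure μ)) : (mk f hf).rep =ᵐ[μ] f :=
  GroupWeight.ae_measure_iff.1 hf.coeFn_toLp

theorem ext_ae {f g : BeurlingAlgebra μ ω} (h : f.rep =ᵐ[μ] g.rep) : f = g :=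
  Lp.ext (GroupWeight.ae_measure_iff.2 h)

theorem rep_add (f g : BeurlingAlgebra μ ω) : (f + g).rep =ᵐ[μ] f.rep + g.rep :=
  GroupWeight.ae_measure_iff.1 (Lp.coeFn_add (show Lp ℂ 1 (ω.measure μ) from f) g)

theorem rep_zero : (0 : BeurlingAlgebra μ ω).rep =ᵐ[μ] 0 :=
  GroupWeight.ae_measure_iff.1 (Lp.coeFn_zero ℂ 1 (ω.measure μ))

theorem rep_smul (c : ℂ) (f : BeurlingAlgebra μ ω) : (c • f).rep =ᵐ[μ] c • f.rep :=
  GroupWeight.ae_measure_iff.1 (Lp.coeFn_smul c (show Lp ℂ 1 (ω.measure μ) from f))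

/-- The norm is `∫ |f| ω dμ`. -/
theorem norm_eq (f : BeurlingAlgebra μ ω) : ‖f‖ = ∫ x, ‖f.rep x‖ * ω.toFun x ∂μ := by
  have h1 := (GroupWeight.memLp_iff.1 f.memLp_rep).1
  rw [integral_eq_lintegral_of_nonneg_ae
    (Filter.Eventually.of_forall fun x => mul_nonneg (norm_nonneg _) (ω.pos x).le)
    (h1.norm.mul ω.continuous_toFun.measurable.aestronglyMeasurable),
    ← toReal_enorm, enorm_eq, eLpNorm_one_eq_lintegral_enorm,
    GroupWeight.lintegral_measure _ h1.enorm]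
  congr 1
  refine lintegral_congr fun x => ?_
  rw [mul_comm (‖f.rep x‖), ENNReal.ofReal_mul (ω.pos x).le, ofReal_norm]
  rfl

variable [IsTopologicalGroup G] [SecondCountableTopology G] [SFinite μ] [μ.IsMulLeftInvariant]

/-- The product is convolution. -/
noncomputable instance : Mul (BeurlingAlgebra μ ω) where
  mul f g := mk (groupConv μ f.rep g.rep) (GroupWeight.memLp_groupConv f.memLp_rep g.memLp_rep)

theorem rep_mul (f g : BeurlingAlgebra μ ω) : (f * g).rep =ᵐ[μ] groupConv μ f.rep g.rep :=
  rep_mk _ _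

theorem mul_assoc' (f g h : BeurlingAlgebra μ ω) : f * g * h = f * (g * h) := by
  refine ext_ae ((rep_mul _ _).trans (Filter.EventuallyEq.trans ?_ (rep_mul _ _).symm))
  rw [groupConv_congr (rep_mul f g) (Filter.EventuallyEq.refl _ h.rep),
    groupConv_congr (Filter.EventuallyEq.refl _ f.rep) (rep_mul g h)]
  exact GroupWeight.groupConv_assoc_ae f.memLp_rep g.memLp_rep h.memLp_rep

theorem left_distrib' (f g h : BeurlingAlgebra μ ω) : f * (g + h) = f * g + f * h := by
  refine ext_ae ((rep_mul _ _).trans (Filter.EventuallyEq.trans ?_ (rep_add _ _).symm))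
  rw [groupConv_congr (Filter.EventuallyEq.refl _ f.rep) (rep_add g h)]
  filter_upwards [rep_mul f g, rep_mul f h,
    GroupWeight.ae_integrable_kernel f.memLp_rep g.memLp_rep,
    GroupWeight.ae_integrable_kernel f.memLp_rep h.memLp_rep] with x h1 h2 h3 h4
  simp only [Pi.add_apply, h1, h2, groupConv, mul_add]
  exact integral_add h3 h4

theorem right_distrib' (f g h : BeurlingAlgebra μ ω) : (f + g) * h = f * h + g * h := by
  refine ext_ae ((rep_mul _ _).trans (Filter.EventuallyEq.trans ?_ (rep_add _ _).symm))
  rw [groupConv_congr (rep_add f g) (Filter.EventuallyEq.refl _ h.rep)]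
  filter_upwards [rep_mul f h, rep_mul g h,
    GroupWeight.ae_integrable_kernel f.memLp_rep h.memLp_rep,
    GroupWeight.ae_integrable_kernel g.memLp_rep h.memLp_rep] with x h1 h2 h3 h4
  simp only [Pi.add_apply, h1, h2, groupConv, add_mul]
  exact integral_add h3 h4

theorem smul_mul' (c : ℂ) (f g : BeurlingAlgebra μ ω) : c • f * g = c • (f * g) := by
  refine ext_ae ((rep_mul _ _).trans (Filter.EventuallyEq.trans ?_ (rep_smul _ _).symm))
  rw [groupConv_congr (rep_smul c f) (Filter.EventuallyEq.refl _ g.rep)]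
  filter_upwards [rep_mul f g] with x h1
  simp only [Pi.smul_apply, h1, groupConv, smul_eq_mul, mul_assoc, integral_const_mul]

theorem mul_smul' (c : ℂ) (f g : BeurlingAlgebra μ ω) : f * c • g = c • (f * g) := by
  refine ext_ae ((rep_mul _ _).trans (Filter.EventuallyEq.trans ?_ (rep_smul _ _).symm))
  rw [groupConv_congr (Filter.EventuallyEq.refl _ f.rep) (rep_smul c g)]
  filter_upwards [rep_mul f g] with x h1
  simp only [Pi.smul_apply, h1, groupConv, smul_eq_mul, mul_left_comm _ c, integral_const_mul]

theorem norm_mul_le' (f g : BeurlingAlgebra μ ω) : ‖f * g‖ ≤ ‖f‖ * ‖g‖ := by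
  have h : ‖f * g‖ₑ ≤ ‖f‖ₑ * ‖g‖ₑ := by
    rw [enorm_eq, enorm_eq f, enorm_eq g,
      eLpNorm_congr_ae (GroupWeight.ae_measure_iff.2 (rep_mul f g))]
    exact GroupWeight.eLpNorm_groupConv_le (GroupWeight.memLp_iff.1 f.memLp_rep).1
      (GroupWeight.memLp_iff.1 g.memLp_rep).1
  have h2 := ENNReal.toReal_mono (ENNReal.mul_ne_top enorm_ne_top enorm_ne_top) h
  simpa [ENNReal.toReal_mul] using h2

noncomputable instance : NonUnitalNormedRing (BeurlingAlgebra μ ω) where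
  __ := (inferInstance : NormedAddCommGroup (BeurlingAlgebra μ ω))
  mul := (· * ·)
  left_distrib := left_distrib'
  right_distrib := right_distrib'
  mul_assoc := mul_assoc'
  zero_mul f := by
    have h := right_distrib' 0 0 f
    rwa [add_zero, left_eq_add] at h
  mul_zero f := by
    have h := left_distrib' f 0 0
    rwa [add_zero, left_eq_add] at h
  norm_mul_le := norm_mul_le'

instance : IsScalarTower ℂ (BeurlingAlgebra μ ω) (BeurlingAlgebra μ ω) := ⟨smul_mul'⟩

instance : SMulCommClass ℂ (BeurlingAlgebra μ ω) (BeurlingAlgebra μ ω) :=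
  ⟨fun c f g => (mul_smul' c f g).symm⟩

end BeurlingAlgebra

/-! ### The affine group -/

/-- The group of affine transformations `x ↦ a x + b` of the real line with `a > 0`. -/
@[ext]
structure AffineGroup where
  /-- the dilation part -/
  a : ℝ
  /-- the translation part -/
  b : ℝ
  a_pos : 0 < a

namespace AffineGroup

instance : Mul AffineGroup := ⟨fun x y => ⟨x.a * y.a, x.a * y.b + x.b, mul_pos x.a_pos y.a_pos⟩⟩

instance : One AffineGroup := ⟨⟨1, 0, one_pos⟩⟩

noncomputable instance : Inv AffineGroup := ⟨fun x => ⟨1 / x.a, -x.b / x.a, one_div_pos.2 x.a_pos⟩⟩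

@[simp] theorem mul_a (x y : AffineGroup) : (x * y).a = x.a * y.a := rfl

@[simp] theorem mul_b (x y : AffineGroup) : (x * y).b = x.a * y.b + x.b := rfl

@[simp] theorem one_a : (1 : AffineGroup).a = 1 := rfl

@[simp] theorem one_b : (1 : AffineGroup).b = 0 := rfl

@[simp] theorem inv_a (x : AffineGroup) : (x⁻¹).a = 1 / x.a := rfl

@[simp] theorem inv_b (x : AffineGroup) : (x⁻¹).b = -x.b / x.a := rfl

noncomputable instance : Group AffineGroup :=
  Group.ofLeftAxioms
    (fun x y z => by ext <;> simp <;> ring)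
    (fun x => by ext <;> simp)
    (fun x => by
      have := x.a_pos.ne'
      ext
      · simp [this]
      · simp only [mul_b, inv_a, inv_b, one_b]; ring)

/-- The coordinates `(a, b)` in the plane. -/
def coords (x : AffineGroup) : ℝ × ℝ := (x.a, x.b)

/-- The topology inherited from the Euclidean plane. -/
instance : TopologicalSpace AffineGroup := TopologicalSpace.induced coords inferInstance

instance : MeasurableSpace AffineGroup := borel AffineGroup

instance : BorelSpace AffineGroup := ⟨rfl⟩

theorem isOpenEmbedding_coords : Topology.IsOpenEmbedding coords where
  eq_induced := rfl
  injective x y h := AffineGroup.ext (congrArg Prod.fst h) (congrArg Prod.snd h)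
  isOpen_range := by
    have : Set.range coords = {p : ℝ × ℝ | 0 < p.1} := by
      ext p
      exact ⟨fun ⟨x, hx⟩ => hx ▸ x.a_pos, fun hp => ⟨⟨p.1, p.2, hp⟩, rfl⟩⟩
    rw [this]
    exact isOpen_lt continuous_const continuous_fst

theorem continuous_a : Continuous AffineGroup.a :=
  continuous_fst.comp isOpenEmbedding_coords.continuous

theorem continuous_b : Continuous AffineGroup.b :=
  continuous_snd.comp isOpenEmbedding_coords.continuous

instance : IsTopologicalGroup AffineGroup where
  continuous_mul := by
    have h1 := continuous_a.comp (continuous_fst (X := AffineGroup) (Y := AffineGroup))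
    have h2 := continuous_a.comp (continuous_snd (X := AffineGroup) (Y := AffineGroup))
    have h3 := continuous_b.comp (continuous_fst (X := AffineGroup) (Y := AffineGroup))
    have h4 := continuous_b.comp (continuous_snd (X := AffineGroup) (Y := AffineGroup))
    exact isOpenEmbedding_coords.isInducing.continuous_iff.2
      ((h1.mul h2).prodMk ((h1.mul h4).add h3))
  continuous_inv := by
    refine isOpenEmbedding_coords.isInducing.continuous_iff.2 (Continuous.prodMk ?_ ?_)
    · exact continuous_const.div continuous_a fun x => x.a_pos.ne'
    · exact continuous_b.neg.div continuous_a fun x => x.a_pos.ne'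

instance : LocallyCompactSpace AffineGroup := isOpenEmbedding_coords.locallyCompactSpace

instance : SecondCountableTopology AffineGroup :=
  isOpenEmbedding_coords.isInducing.secondCountableTopology

instance : T2Space AffineGroup := isOpenEmbedding_coords.isEmbedding.t2Space

/-- The polynomial weight `ω_α(a, b) = (1 + a + |b|) ^ α`. -/
noncomputable def polyWeight (α : ℝ) (hα : 0 < α) : GroupWeight AffineGroup where
  toFun x := (1 + x.a + |x.b|) ^ α
  continuous_toFun :=
    ((continuous_const.add continuous_a).add continuous_b.abs).rpow_const fun _ => Or.inr hα.le
  pos x := by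
    have := x.a_pos
    positivity
  submul x y := by
    have hx := x.a_pos
    have hy := y.a_pos
    rw [← Real.mul_rpow (by positivity) (by positivity)]
    refine Real.rpow_le_rpow (by simp only [mul_a]; positivity) ?_ hα.le
    have h : |x.a * y.b + x.b| ≤ x.a * |y.b| + |x.b| :=
      (abs_add_le _ _).trans (by rw [abs_mul, abs_of_pos hx])
    simp only [mul_a, mul_b]
    nlinarith [mul_nonneg (abs_nonneg x.b) hy.le, mul_nonneg (abs_nonneg x.b) (abs_nonneg y.b),
      abs_nonneg y.b]

end AffineGroup

/-! ### Bilinear forms on Beurling algebras given by kernels -/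

/-! Let `a` be the dilation coordinate, a homomorphism from the affine group to the positive reals.
Multiplication by `log a` is formally a derivation `δ` of the convolution algebra, since `log a` is
additive. The functional `τ(f) = ∫ f` over `{a ≥ 1}` is a bounded trace, since `a(xy) = a(yx)`.
Hence `D(f)(g) = τ(δ(f) * g)` is formally a derivation into the dual; its kernel is `K(x, y) = log
a(x)` on `{a(xy) ≥ 1}` and `0` elsewhere.

The operator `δ` itself is not bounded: the weight stays bounded as `a → 0` with `b` bounded, while
`log a → -∞`. The cutoff in `τ` repairs this. Where `a(x) a(y) ≥ 1`, one has `-log a(y) ≤ log a(x)`,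
so a very negative `log a(x)` is paid for by `y`. Together with `log t ≤ t ^ α / α` this gives
`|K(x, y)| ≤ α⁻¹ ω(x) ω(y)` (`abs_logKernel_le`), so `D` is bounded.

The derivation law becomes the pointwise identity `logKernel_cocycle`, transferred to the algebra by
`isDerivationToDual_kernelOperator`. An inner derivation satisfies `D(f)(f) = 0` for every `f`
(`IsInnerToDual.apply_self`), whereas `D(f)(f) > 0` for the indicator `f` of a compact box on which
`a ≥ 2` (`kernelForm_logKernel_box_ne_zero`). -/

section Forms

variable {G : Type*} [MeasurableSpace G] {μ : Measure G}

/-- The bilinear form with kernel `K`. -/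
noncomputable def kernelForm (μ : Measure G) (K : G × G → ℂ) (f g : G → ℂ) : ℂ :=
  ∫ p, K p * (f p.1 * g p.2) ∂(μ.prod μ)

/-- The trilinear form with kernel `N`. -/
noncomputable def kernelForm₃ (μ : Measure G) (N : G × G × G → ℂ) (f g h : G → ℂ) : ℂ :=
  ∫ p, N p * (f p.1 * (g p.2.1 * h p.2.2)) ∂(μ.prod (μ.prod μ))

theorem kernelForm_congr (K : G × G → ℂ) {f f' g g' : G → ℂ} (hf : f =ᵐ[μ] f')
    (hg : g =ᵐ[μ] g') : kernelForm μ K f g = kernelForm μ K f' g' := by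
  refine integral_congr_ae ?_
  filter_upwards [Measure.quasiMeasurePreserving_fst.ae_eq_comp hf,
    Measure.quasiMeasurePreserving_snd.ae_eq_comp hg] with p h1 h2
  simp only [Function.comp] at h1 h2
  rw [h1, h2]

variable [SFinite μ]

theorem kernelForm_swap (K : G × G → ℂ) (f g : G → ℂ) :
    kernelForm μ K f g = kernelForm μ (fun p => K p.swap) g f := by
  rw [kernelForm, ← integral_prod_swap]
  simp only [kernelForm, Prod.fst_swap, Prod.snd_swap, mul_comm (f _)]

/-- The triple product measure is invariant under cyclic permutation of the factors. This brings the
three terms of the derivation identity, which arise with `f`, `g`, `h` in different cyclic orders,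
to a common order. -/
theorem kernelForm₃_rotate (N : G × G × G → ℂ) (f g h : G → ℂ) :
    kernelForm₃ μ N f g h = kernelForm₃ μ (fun p => N (p.2.2, p.1, p.2.1)) g h f := by
  have hm : MeasurePreserving
      (MeasurableEquiv.prodAssoc.symm.trans MeasurableEquiv.prodComm : G × G × G ≃ᵐ G × G × G)
      (μ.prod (μ.prod μ)) (μ.prod (μ.prod μ)) :=
    Measure.measurePreserving_swap.comp (measurePreserving_prodAssoc μ μ μ).symm
  rw [kernelForm₃, ← hm.integral_comp']
  refine integral_congr_ae (Filter.Eventually.of_forall fun p => ?_)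
  change N (p.2.2, p.1, p.2.1) * (f p.2.2 * (g p.1 * h p.2.1)) = _
  ring

end Forms

/-! ### Kernels dominated by the weight, and the operators into the dual that they define. -/

section Kernel

variable {G : Type*} [Group G] [TopologicalSpace G] [MeasurableSpace G] [BorelSpace G]
  {ω : GroupWeight G} {μ : Measure G}

theorem GroupWeight.integrable_norm_mul {f : G → ℂ} (hf : MemLp f 1 (ω.measure μ)) :
    Integrable (fun x => ‖f x‖ * ω.toFun x) μ := by
  obtain ⟨h1, h2⟩ := GroupWeight.memLp_iff.1 hf
  refine ⟨h1.norm.mul ω.continuous_toFun.measurable.aestronglyMeasurable, ?_⟩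
  refine lt_of_eq_of_lt (lintegral_congr fun x => ?_) h2
  rw [enorm_mul, enorm_norm, mul_comm, Real.enorm_of_nonneg (ω.pos x).le]
  rfl

theorem integrable_kernelForm {K : G × G → ℂ} {C : ℝ} (hK : Measurable K)
    (hC : ∀ p, ‖K p‖ ≤ C * (ω.toFun p.1 * ω.toFun p.2)) {f g : G → ℂ}
    (hf : MemLp f 1 (ω.measure μ)) (hg : MemLp g 1 (ω.measure μ)) :
    Integrable (fun p => K p * (f p.1 * g p.2)) (μ.prod μ) := by
  have hf1 := (GroupWeight.memLp_iff.1 hf).1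
  have hg1 := (GroupWeight.memLp_iff.1 hg).1
  refine (((GroupWeight.integrable_norm_mul hf).mul_prod
    (GroupWeight.integrable_norm_mul hg)).const_mul C).mono'
    (hK.aestronglyMeasurable.mul (hf1.comp_fst.mul hg1.comp_snd))
    (Filter.Eventually.of_forall fun p => ?_)
  rw [norm_mul, norm_mul]
  calc _ ≤ _ := mul_le_mul_of_nonneg_right (hC p) (by positivity)
    _ = _ := by ring

theorem integrable_kernelForm₃ {N : G × G × G → ℂ} {C : ℝ} (hN : Measurable N)
    (hC : ∀ p, ‖N p‖ ≤ C * (ω.toFun p.1 * (ω.toFun p.2.1 * ω.toFun p.2.2))) {f g h : G → ℂ}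
    (hf : MemLp f 1 (ω.measure μ)) (hg : MemLp g 1 (ω.measure μ))
    (hh : MemLp h 1 (ω.measure μ)) :
    Integrable (fun p => N p * (f p.1 * (g p.2.1 * h p.2.2))) (μ.prod (μ.prod μ)) := by
  have hf1 := (GroupWeight.memLp_iff.1 hf).1
  have hg1 := (GroupWeight.memLp_iff.1 hg).1
  have hh1 := (GroupWeight.memLp_iff.1 hh).1
  refine (((GroupWeight.integrable_norm_mul hf).mul_prod
    ((GroupWeight.integrable_norm_mul hg).mul_prod
      (GroupWeight.integrable_norm_mul hh))).const_mul C).mono'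
    (hN.aestronglyMeasurable.mul (hf1.comp_fst.mul (hg1.comp_fst.mul hh1.comp_snd).comp_snd))
    (Filter.Eventually.of_forall fun p => ?_)
  rw [norm_mul, norm_mul, norm_mul]
  calc _ ≤ _ := mul_le_mul_of_nonneg_right (hC p) (by positivity)
    _ = _ := by ring

variable [SFinite μ]

theorem norm_kernelForm_le {K : G × G → ℂ} {C : ℝ}
    (hC : ∀ p, ‖K p‖ ≤ C * (ω.toFun p.1 * ω.toFun p.2)) (f g : BeurlingAlgebra μ ω) :
    ‖kernelForm μ K f.rep g.rep‖ ≤ C * ‖f‖ * ‖g‖ := by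
  rw [BeurlingAlgebra.norm_eq f, BeurlingAlgebra.norm_eq g, mul_assoc, ← integral_prod_mul,
    ← integral_const_mul]
  refine norm_integral_le_of_norm_le (((GroupWeight.integrable_norm_mul f.memLp_rep).mul_prod
    (GroupWeight.integrable_norm_mul g.memLp_rep)).const_mul C)
    (Filter.Eventually.of_forall fun p => ?_)
  rw [norm_mul, norm_mul]
  calc _ ≤ _ := mul_le_mul_of_nonneg_right (hC p) (by positivity)
    _ = _ := by ring

variable [IsTopologicalGroup G] [SecondCountableTopology G] [μ.IsMulLeftInvariant]

/-- Fubini, followed by the left translation `u ↦ x u` in the variable of the convolution.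
Submultiplicativity of the weight makes the trilinear integrand absolutely integrable. -/
theorem kernelForm_groupConv_left {K : G × G → ℂ} {C : ℝ} (hK : Measurable K)
    (hC : ∀ p, ‖K p‖ ≤ C * (ω.toFun p.1 * ω.toFun p.2)) {f g h : G → ℂ}
    (hf : MemLp f 1 (ω.measure μ)) (hg : MemLp g 1 (ω.measure μ))
    (hh : MemLp h 1 (ω.measure μ)) :
    kernelForm μ K (groupConv μ f g) h =
      kernelForm₃ μ (fun p => K (p.1 * p.2.1, p.2.2)) f g h := by
  -- The bound at the identity, where the weights are positive, forces `C ≥ 0`.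
  have hC0 : 0 ≤ C := by
    have h1 := (norm_nonneg _).trans (hC 1)
    exact nonneg_of_mul_nonneg_left h1 (mul_pos (ω.pos _) (ω.pos _))
  have hN : Integrable (fun p : G × G × G =>
      K (p.1 * p.2.1, p.2.2) * (f p.1 * (g p.2.1 * h p.2.2))) (μ.prod (μ.prod μ)) := by
    refine integrable_kernelForm₃ (N := fun p => K (p.1 * p.2.1, p.2.2)) (C := C)
      (hK.comp (by fun_prop)) (fun p => (hC _).trans ?_) hf hg hh
    rw [← mul_assoc (ω.toFun p.1)]
    exact mul_le_mul_of_nonneg_left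
      (mul_le_mul_of_nonneg_right (ω.submul _ _) (ω.pos _).le) hC0
  -- The shear `(x, u, z) ↦ (x, x⁻¹ u, z)` is, for each fixed `x`, a left translation of `G × G`. It
  -- carries the integrability `hN` over to the integrand in the original variables, as needed for
  -- exchanging the integrals.
  have hs : MeasurePreserving (fun p : G × G × G => (p.1, (p.1⁻¹, (1 : G)) * p.2))
      (μ.prod (μ.prod μ)) (μ.prod (μ.prod μ)) :=
    (MeasurePreserving.id μ).skew_product (g := fun x q => (x⁻¹, (1 : G)) * q) (by fun_prop)
      (Filter.Eventually.of_forall fun x => map_mul_left_eq_self (μ.prod μ) (x⁻¹, (1 : G)))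
  have hN' := hs.integrable_comp_of_integrable hN
  calc kernelForm μ K (groupConv μ f g) h
      = ∫ q, ∫ x, K q * (f x * (g (x⁻¹ * q.1) * h q.2)) ∂μ ∂(μ.prod μ) := by
        refine integral_congr_ae (Filter.Eventually.of_forall fun q => ?_)
        simp only [groupConv]
        rw [integral_const_mul]
        simp only [← mul_assoc]
        rw [integral_mul_const, mul_assoc]
    _ = ∫ x, ∫ q, K q * (f x * (g (x⁻¹ * q.1) * h q.2)) ∂(μ.prod μ) ∂μ := by
        refine (integral_integral_swap ?_).symm
        simpa [Function.comp_def, Function.uncurry_def] using hN'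
    _ = ∫ x, ∫ q : G × G, K (x * q.1, q.2) * (f x * (g q.1 * h q.2)) ∂(μ.prod μ) ∂μ := by
        refine integral_congr_ae (Filter.Eventually.of_forall fun x => ?_)
        simp only
        rw [← integral_mul_left_eq_self _ ((x, 1) : G × G)]
        refine integral_congr_ae (Filter.Eventually.of_forall fun q => ?_)
        simp only [Prod.fst_mul, Prod.snd_mul, one_mul, inv_mul_cancel_left]
        rw [show (x, (1 : G)) * q = (x * q.1, q.2) from Prod.ext rfl (one_mul _)]
    _ = _ := (integral_prod _ hN).symm

theorem kernelForm_groupConv_right {K : G × G → ℂ} {C : ℝ} (hK : Measurable K)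
    (hC : ∀ p, ‖K p‖ ≤ C * (ω.toFun p.1 * ω.toFun p.2)) {f g h : G → ℂ}
    (hf : MemLp f 1 (ω.measure μ)) (hg : MemLp g 1 (ω.measure μ))
    (hh : MemLp h 1 (ω.measure μ)) :
    kernelForm μ K h (groupConv μ f g) =
      kernelForm₃ μ (fun p => K (p.2.2, p.1 * p.2.1)) f g h := by
  rw [kernelForm_swap, kernelForm_groupConv_left (ω := ω) (C := C)
    (K := fun p => K p.swap) (hK.comp measurable_swap)
    (fun p => (hC _).trans_eq (by simp [mul_comm])) hf hg hh]
  rfl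

/-- The bounded operator into the dual given by a kernel dominated by the weight. -/
noncomputable def kernelOperator (K : G × G → ℂ) (C : ℝ) (hK : Measurable K)
    (hC : ∀ p, ‖K p‖ ≤ C * (ω.toFun p.1 * ω.toFun p.2)) :
    BeurlingAlgebra μ ω →L[ℂ] BeurlingAlgebra μ ω →L[ℂ] ℂ :=
  LinearMap.mkContinuous₂
    (LinearMap.mk₂ ℂ (fun f g : BeurlingAlgebra μ ω => kernelForm μ K f.rep g.rep)
      (fun f f' g => by
        rw [kernelForm_congr K (BeurlingAlgebra.rep_add f f') (Filter.EventuallyEq.refl _ g.rep)]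
        simp only [kernelForm, Pi.add_apply, add_mul, mul_add]
        exact integral_add (integrable_kernelForm hK hC f.memLp_rep g.memLp_rep)
          (integrable_kernelForm hK hC f'.memLp_rep g.memLp_rep))
      (fun c f g => by
        rw [kernelForm_congr K (BeurlingAlgebra.rep_smul c f) (Filter.EventuallyEq.refl _ g.rep)]
        simp only [kernelForm, Pi.smul_apply, smul_eq_mul, mul_assoc, mul_left_comm _ c,
          integral_const_mul])
      (fun f g g' => by
        rw [kernelForm_congr K (Filter.EventuallyEq.refl _ f.rep) (BeurlingAlgebra.rep_add g g')]
        simp only [kernelForm, Pi.add_apply, mul_add]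
        exact integral_add (integrable_kernelForm hK hC f.memLp_rep g.memLp_rep)
          (integrable_kernelForm hK hC f.memLp_rep g'.memLp_rep))
      (fun c f g => by
        rw [kernelForm_congr K (Filter.EventuallyEq.refl _ f.rep) (BeurlingAlgebra.rep_smul c g)]
        simp only [kernelForm, Pi.smul_apply, smul_eq_mul, mul_left_comm _ c,
          integral_const_mul]))
    C (norm_kernelForm_le hC)

theorem kernelOperator_apply {K : G × G → ℂ} {C : ℝ} (hK : Measurable K)
    (hC : ∀ p, ‖K p‖ ≤ C * (ω.toFun p.1 * ω.toFun p.2)) (f g : BeurlingAlgebra μ ω) :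
    kernelOperator K C hK hC f g = kernelForm μ K f.rep g.rep := rfl

/-- A kernel satisfying the cocycle identity gives a derivation. -/
theorem isDerivationToDual_kernelOperator {K : G × G → ℂ} {C : ℝ} (hK : Measurable K)
    (hC : ∀ p, ‖K p‖ ≤ C * (ω.toFun p.1 * ω.toFun p.2))
    (hcocycle : ∀ x y z, K (x * y, z) = K (y, z * x) + K (x, y * z)) :
    IsDerivationToDual (kernelOperator (μ := μ) K C hK hC) := by
  intro f g
  ext h
  have hf := f.memLp_rep
  have hg := g.memLp_rep
  have hh := h.memLp_rep
  have hC0 : 0 ≤ C := by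
    have h1 := (norm_nonneg _).trans (hC 1)
    exact nonneg_of_mul_nonneg_left h1 (mul_pos (ω.pos _) (ω.pos _))
  rw [add_apply, dualLeft_apply, dualRight_apply]
  simp only [kernelOperator_apply]
  -- All three terms become trilinear forms in `f`, `g`, `h`, with kernels `K(xy, z)`, `K(y, zx)`
  -- and `K(x, yz)`. The two rotations, in opposite directions, restore the order `f`, `g`, `h`,
  -- after which the cocycle identity applies under the integral.
  rw [kernelForm_congr K (BeurlingAlgebra.rep_mul f g) (Filter.EventuallyEq.refl _ h.rep),
    kernelForm_congr K (Filter.EventuallyEq.refl _ g.rep) (BeurlingAlgebra.rep_mul h f),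
    kernelForm_congr K (Filter.EventuallyEq.refl _ f.rep) (BeurlingAlgebra.rep_mul g h),
    kernelForm_groupConv_left hK hC hf hg hh, kernelForm_groupConv_right hK hC hh hf hg,
    kernelForm_groupConv_right hK hC hg hh hf, kernelForm₃_rotate _ h.rep,
    ← kernelForm₃_rotate (fun p => K (p.1, p.2.1 * p.2.2)) f.rep]
  simp only [kernelForm₃]
  rw [← integral_add]
  · refine integral_congr_ae (Filter.Eventually.of_forall fun p => ?_)
    simp only [hcocycle, add_mul]
  · refine integrable_kernelForm₃ (N := fun p => K (p.2.1, p.2.2 * p.1)) (C := C)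
      (hK.comp (by fun_prop)) (fun p => (hC _).trans ?_) hf hg hh
    refine mul_le_mul_of_nonneg_left ?_ hC0
    calc _ ≤ _ := mul_le_mul_of_nonneg_left (ω.submul _ _) (ω.pos _).le
      _ = _ := by ring
  · refine integrable_kernelForm₃ (N := fun p => K (p.1, p.2.1 * p.2.2)) (C := C)
      (hK.comp (by fun_prop)) (fun p => (hC _).trans ?_) hf hg hh
    exact mul_le_mul_of_nonneg_left
      (mul_le_mul_of_nonneg_left (ω.submul _ _) (ω.pos _).le) hC0

end Kernel

/-- On the diagonal both module actions give `φ (a * a)`. This is the obstruction used against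
innerness. -/
theorem IsInnerToDual.apply_self {A : Type*} [NonUnitalNormedRing A] [NormedSpace ℂ A]
    [IsScalarTower ℂ A A] [SMulCommClass ℂ A A] {D : A →L[ℂ] (A →L[ℂ] ℂ)}
    (hD : IsInnerToDual D) (a : A) : D a a = 0 := by
  obtain ⟨φ, hφ⟩ := hD
  rw [hφ a, sub_apply, dualLeft_apply, dualRight_apply, sub_self]

/-! ### A non-inner derivation for the affine group -/

namespace AffineGroup

/-- The kernel `log a(x)` restricted to `a(xy) ≥ 1`. -/
noncomputable def logKernel (p : AffineGroup × AffineGroup) : ℝ :=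
  {p : AffineGroup × AffineGroup | 1 ≤ p.1.a * p.2.a}.indicator (fun p => Real.log p.1.a) p

theorem measurable_logKernel : Measurable logKernel := by
  have ha := continuous_a.measurable
  refine Measurable.indicator (Real.measurable_log.comp (ha.comp measurable_fst)) ?_
  exact measurableSet_le measurable_const ((ha.comp measurable_fst).mul (ha.comp measurable_snd))

/-- Since `a` is a homomorphism to a commutative group, all three cutoffs are the single condition
`a(x) a(y) a(z) ≥ 1`. Where it holds, the identity is the additivity of `log`; elsewhere every term
vanishes. -/
theorem logKernel_cocycle (x y z : AffineGroup) :
    logKernel (x * y, z) = logKernel (y, z * x) + logKernel (x, y * z) := by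
  have h2 : y.a * (z.a * x.a) = x.a * y.a * z.a := by ring
  have h3 : x.a * (y.a * z.a) = x.a * y.a * z.a := by ring
  simp only [logKernel, Set.indicator_apply, Set.mem_ofPred_eq, mul_a, h2, h3]
  split_ifs
  · rw [Real.log_mul x.a_pos.ne' y.a_pos.ne', add_comm]
  · simp

/-- The constant comes from `log t ≤ t ^ α / α`, and `a ^ α` is at most the weight. Because the
weight is at least `1`, a bound by either single factor gives a bound by the product. -/
theorem abs_logKernel_le {α : ℝ} (hα : 0 < α) (p : AffineGroup × AffineGroup) :
    |logKernel p| ≤ α⁻¹ * ((polyWeight α hα).toFun p.1 * (polyWeight α hα).toFun p.2) := by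
  obtain ⟨x, y⟩ := p
  have hx := x.a_pos
  have hy := y.a_pos
  have hone : ∀ z : AffineGroup, 1 ≤ (polyWeight α hα).toFun z := fun z =>
    Real.one_le_rpow (by linarith [z.a_pos, abs_nonneg z.b]) hα.le
  have hlog : ∀ z : AffineGroup, Real.log z.a ≤ α⁻¹ * (polyWeight α hα).toFun z := fun z => by
    have h1 := Real.log_le_rpow_div z.a_pos.le hα
    have h2 : z.a ^ α ≤ (polyWeight α hα).toFun z :=
      Real.rpow_le_rpow z.a_pos.le (by linarith [abs_nonneg z.b]) hα.le
    calc _ ≤ _ := h1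
      _ = α⁻¹ * z.a ^ α := by ring
      _ ≤ _ := by gcongr
  have hα' : 0 ≤ α⁻¹ := (inv_pos.2 hα).le
  have hwx := hone x
  have hwy := hone y
  have hx' : α⁻¹ * (polyWeight α hα).toFun x ≤
      α⁻¹ * ((polyWeight α hα).toFun x * (polyWeight α hα).toFun y) :=
    mul_le_mul_of_nonneg_left (le_mul_of_one_le_right (by linarith) hwy) hα'
  have hy' : α⁻¹ * (polyWeight α hα).toFun y ≤
      α⁻¹ * ((polyWeight α hα).toFun x * (polyWeight α hα).toFun y) :=
    mul_le_mul_of_nonneg_left (le_mul_of_one_le_left (by linarith) hwx) hα'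
  simp only [logKernel, Set.indicator_apply, Set.mem_ofPred_eq]
  split_ifs with h
  · have h1 : 0 ≤ Real.log x.a + Real.log y.a := by
      rw [← Real.log_mul hx.ne' hy.ne']
      exact Real.log_nonneg h
    -- The cutoff gives `log a(x) ≥ -log a(y)`, so the lower bound is controlled by the weight at
    -- `y` and the upper bound by the weight at `x`.
    exact abs_le.2 ⟨by linarith [hlog y], (hlog x).trans hx'⟩
  · rw [abs_zero]
    exact mul_nonneg hα' (by nlinarith)

/-- The box `2 ≤ a ≤ 3`, `0 ≤ b ≤ 1`. -/
def box : Set AffineGroup := coords ⁻¹' (Set.Icc 2 3 ×ˢ Set.Icc 0 1)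

theorem isCompact_box : IsCompact box := by
  refine isOpenEmbedding_coords.isInducing.isCompact_preimage_iff ?_ |>.2
    (isCompact_Icc.prod isCompact_Icc)
  -- The closed box lies inside the open half-plane `a > 0`, the range of the coordinates, so its
  -- preimage stays compact.
  rintro ⟨s, t⟩ h
  exact ⟨⟨s, t, by linarith [h.1.1]⟩, rfl⟩

theorem measurableSet_box : MeasurableSet box := isCompact_box.measurableSet

theorem measure_box_pos (μ : Measure AffineGroup) [μ.IsHaarMeasure] : 0 < μ box := by
  have ho : IsOpen (coords ⁻¹' (Set.Ioo 2 3 ×ˢ Set.Ioo 0 1)) :=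
    (isOpen_Ioo.prod isOpen_Ioo).preimage isOpenEmbedding_coords.continuous
  refine (ho.measure_pos μ ⟨⟨5 / 2, 1 / 2, by norm_num⟩, ?_⟩).trans_le (measure_mono ?_)
  · simp only [coords, Set.mem_preimage, Set.mem_prod, Set.mem_Ioo]
    norm_num
  · exact Set.preimage_mono (Set.prod_mono Set.Ioo_subset_Icc_self Set.Ioo_subset_Icc_self)

theorem memLp_indicator_box (μ : Measure AffineGroup) [μ.IsHaarMeasure]
    (ω : GroupWeight AffineGroup) :
    MemLp (box.indicator fun _ => (1 : ℂ)) 1 (ω.measure μ) := by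
  refine memLp_indicator_const 1 measurableSet_box 1 (Or.inr ?_)
  have h := (ω.continuous_toFun.continuousOn.integrableOn_compact (μ := μ) isCompact_box).2
  rw [GroupWeight.measure, withDensity_apply _ measurableSet_box]
  refine ne_of_lt (lt_of_eq_of_lt (lintegral_congr fun x => ?_) h)
  rw [Real.enorm_of_nonneg (ω.pos x).le]
  rfl

/-- For two points of the box the product of dilations is at least `4`, so the cutoff is inactive
and the kernel is at least `log 2`. The form is therefore at least `log 2` times the square of the
positive, finite measure of the box. The upper bound `log 3` serves only integrability. -/
theorem kernelForm_logKernel_box_ne_zero (μ : Measure AffineGroup) [μ.IsHaarMeasure] :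
    kernelForm μ (fun p => (logKernel p : ℂ)) (box.indicator fun _ => 1)
      (box.indicator fun _ => 1) ≠ 0 := by
  have hfin : μ.prod μ (box ×ˢ box) ≠ ∞ := (isCompact_box.prod isCompact_box).measure_ne_top
  have hms := measurableSet_box.prod measurableSet_box
  have hbox : ∀ x ∈ box, 2 ≤ x.a ∧ x.a ≤ 3 := fun x hx => hx.1
  have hlow : ∀ p ∈ box ×ˢ box, Real.log 2 ≤ logKernel p := fun p hp => by
    have h1 := hbox _ hp.1
    have h2 := hbox _ hp.2
    have h3 : 1 ≤ p.1.a * p.2.a := by nlinarith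
    rw [logKernel, Set.indicator_of_mem (by exact h3)]
    exact Real.log_le_log (by norm_num) h1.1
  have hupp : ∀ p ∈ box ×ˢ box, ‖logKernel p‖ ≤ Real.log 3 := fun p hp => by
    have h1 := hbox _ hp.1
    have h2 := hbox _ hp.2
    have h3 : 1 ≤ p.1.a * p.2.a := by nlinarith
    rw [logKernel, Set.indicator_of_mem (by exact h3), Real.norm_of_nonneg
      (Real.log_nonneg (by linarith))]
    exact Real.log_le_log p.1.a_pos h1.2
  have hint : IntegrableOn logKernel (box ×ˢ box) (μ.prod μ) :=
    Measure.integrableOn_of_bounded hfin measurable_logKernel.aestronglyMeasurable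
      ((ae_restrict_iff' hms).2 (Filter.Eventually.of_forall hupp))
  have hval : kernelForm μ (fun p => (logKernel p : ℂ)) (box.indicator fun _ => 1)
      (box.indicator fun _ => 1) = ((∫ p in box ×ˢ box, logKernel p ∂(μ.prod μ) : ℝ) : ℂ) := by
    rw [← integral_complex_ofReal, ← integral_indicator hms]
    refine integral_congr_ae (Filter.Eventually.of_forall fun p => ?_)
    by_cases h1 : p.1 ∈ box <;> by_cases h2 : p.2 ∈ box <;> simp [h1, h2]
  have hpos : 0 < (μ.prod μ).real (box ×ˢ box) := by
    refine ENNReal.toReal_pos ?_ hfin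
    rw [Measure.prod_prod]
    exact mul_ne_zero (measure_box_pos μ).ne' (measure_box_pos μ).ne'
  have hge := setIntegral_ge_of_const_le_real hms hfin hlow hint
  rw [hval, Complex.ofReal_ne_zero]
  exact ((mul_pos (Real.log_pos one_lt_two) hpos).trans_le hge).ne'

end AffineGroup

theorem mainTheorem6 (μ : MeasureTheory.Measure AffineGroup) [μ.IsHaarMeasure]
    (α : ℝ) (hα : 0 < α) :
    ¬ IsWeaklyAmenable (BeurlingAlgebra μ (AffineGroup.polyWeight α hα)) := by
  intro hw
  have hK : Measurable fun p => (AffineGroup.logKernel p : ℂ) :=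
    Complex.measurable_ofReal.comp AffineGroup.measurable_logKernel
  have hC : ∀ p, ‖(AffineGroup.logKernel p : ℂ)‖ ≤ α⁻¹ *
      ((AffineGroup.polyWeight α hα).toFun p.1 * (AffineGroup.polyWeight α hα).toFun p.2) :=
    fun p => by
      rw [Complex.norm_real]
      exact AffineGroup.abs_logKernel_le hα p
  have hD := hw _ (isDerivationToDual_kernelOperator (μ := μ) hK hC fun x y z => by
    rw [AffineGroup.logKernel_cocycle, Complex.ofReal_add])
  have hf := AffineGroup.memLp_indicator_box μ (AffineGroup.polyWeight α hα)
  -- Innerness would make the derivation vanish on the diagonal at the class of the box indicator.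
  have h0 := hD.apply_self (BeurlingAlgebra.mk _ hf)
  rw [kernelOperator_apply, kernelForm_congr _ (BeurlingAlgebra.rep_mk _ hf)
    (BeurlingAlgebra.rep_mk _ hf)] at h0
  exact AffineGroup.kernelForm_logKernel_box_ne_zero μ h0
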